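/- Lattices are bounded and distributive, and lattice homomorphisms preserve $0$ and $1$. For an MV-algebra $A$, the Belluce lattice $\beta(A)$ is the quotient of $A$ which identifies two elements when they belong to the same prime ideals of $A$, with the lattice operations induced by those of $A$. For a lattice $L$, let $Spec(L)$ be the set of prime ideals of $L$. The Stone dual of $L$ is $Spec(L)$ with the Zariski topology, generated by the sets $\{P \mid a\notin P\}$, $a\in L$. The Priestley dual of $L$ is $Spec(L)$ with the inclusion order and the patch topology, generated by the sets $\{P\mid a\in P\}$ and $\{P\mid a\notin P\}$, $a\in L$. The Stone dual and the Priestley dual of a homomorphism $f:L\to L'$ are both the map $f^{-1}:Spec(L')\to Spec(L)$. A Priestley space is a compact, partially ordered topological space such that whenever $x\not\le y$ there is a clopen upset containing $x$ but not $y$; Priestley maps are the continuous order-preserving maps. Let $LIC$ be the category whose objects are the triples $(K,L,f)$ where $K$ is (isomorphic to) the Belluce lattice of a free MV-algebra, $L$ is a lattice and $f:K\to L$ is an epimorphism of lattices whose Stone dual sends closed sets to closed sets; a morphism $(K_1,L_1,f)\to(K_2,L_2,g)$ is a pair of lattice homomorphisms $s:K_1\to K_2$, $t:L_1\to L_2$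 with $t\circ f=g\circ s$. Let $PIC$ be the category whose objects are the triples $(\Xi_1,\Xi_2,g)$ where $\Xi_1$ is (isomorphic to) the Priestley dual of the Belluce lattice of a free MV-algebra, $\Xi_2$ is a Priestley space and $g:\Xi_2\to\Xi_1$ is an injective Priestley map which sends closed upsets to closed upsets; a morphism $(\Xi_1,\Xi_2,g)\to(\Xi_1',\Xi_2',g')$ is a pair of Priestley maps $s:\Xi_1\to\Xi_1'$, $t:\Xi_2\to\Xi_2'$ with $g'\circ t=s\circ g$. Theorem. Priestley duality gives a duality between $LIC$ and $PIC$: sending $(K,L,f)$ to the triple of the Priestley duals of $K$, $L$ and $f$, and a morphism $(s,t)$ to the pair of the Priestley duals of $s$ and $t$, defines a contravariant functor from $LIC$ to $PIC$ which is a dual equivalence of categories. -/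

import Mathlib

open CategoryTheory
open scoped Topology

universe u

/-! ## MV-algebras and their prime ideals -/

/-- An MV-algebra `(A, ⊕, 0, ¬)`; here `x ⊕ y` is written `x + y` and `¬ x` is written `xᶜ`. -/
class MVAlgebra (A : Type u) extends AddCommMonoid A, Compl A where
  compl_compl' : ∀ x : A, xᶜᶜ = x
  add_one' : ∀ x : A, x + (0 : A)ᶜ = (0 : A)ᶜ
  luk : ∀ x y : A, (xᶜ + y)ᶜ + y = (yᶜ + x)ᶜ + x

namespace MVAlgebra

variable {A : Type u} [MVAlgebra A]

/-- The greatest element `1 = ¬ 0`. -/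
def one : A := (0 : A)ᶜ

/-- The join `x ∨ y = ¬(¬ x ⊕ y) ⊕ y`. -/
def join (x y : A) : A := (xᶜ + y)ᶜ + y

/-- The meet `x ∧ y = ¬(¬ x ∨ ¬ y)`. -/
def meet (x y : A) : A := (join xᶜ yᶜ)ᶜ

/-- The natural order of an MV-algebra: `x ≤ y` iff `x ∨ y = y`. -/
def le (x y : A) : Prop := join x y = y

theorem compl_add_self (x : A) : xᶜ + x = (0 : A)ᶜ := by
  have h := luk x (0 : A)ᶜ
  rw [add_one', compl_compl', zero_add] at h
  exact h.symm

theorem le_iff {x y : A} : le x y ↔ xᶜ + y = (0 : A)ᶜ := by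
  unfold le join
  constructor
  · intro h
    rw [← h, ← add_assoc, add_comm xᶜ, add_assoc, compl_add_self]
  · intro h
    rw [h, compl_compl', zero_add]

theorem zero_le (x : A) : le 0 x := by
  rw [le_iff, add_comm, add_one']

theorem le_one (x : A) : le x one := by
  rw [le_iff, one, add_one']

theorem join_comm (x y : A) : join x y = join y x := luk x y

theorem le_join_right (x y : A) : le y (join x y) := by
  rw [le_iff, join, add_comm, add_assoc, add_comm y, compl_add_self, add_one']

theorem le_join_left (x y : A) : le x (join x y) := by
  rw [join_comm]; exact le_join_right y x

theorem meet_le_left (x y : A) : le (meet x y) x := by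
  have h := le_join_left xᶜ yᶜ
  rw [le_iff, compl_compl'] at h
  rw [le_iff, meet, compl_compl', add_comm, h]

theorem meet_le_right (x y : A) : le (meet x y) y := by
  have h := le_join_right xᶜ yᶜ
  rw [le_iff, compl_compl'] at h
  rw [le_iff, meet, compl_compl', add_comm, h]

theorem join_le_add (x y : A) : le (join x y) (x + y) := by
  rw [le_iff, join, add_comm x y, ← add_assoc, luk (xᶜ + y) y, add_assoc, add_assoc xᶜ,
    add_comm y x, ← add_assoc xᶜ, compl_add_self, add_comm (0 : A)ᶜ, add_one', add_one']

/-- An ideal of an MV-algebra: a nonempty subset closed under `⊕` and downward closed. -/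
structure IsIdeal (I : Set A) : Prop where
  nonempty : I.Nonempty
  add_mem : ∀ {x y : A}, x ∈ I → y ∈ I → x + y ∈ I
  mem_of_le : ∀ {x y : A}, x ∈ I → le y x → y ∈ I

/-- A prime ideal of an MV-algebra. -/
structure IsPrimeIdeal (P : Set A) : Prop extends IsIdeal P where
  ne_univ : P ≠ Set.univ
  mem_or_mem : ∀ {x y : A}, meet x y ∈ P → x ∈ P ∨ y ∈ P

theorem IsPrimeIdeal.join_mem_iff {P : Set A} (hP : IsPrimeIdeal P) (x y : A) :
    join x y ∈ P ↔ x ∈ P ∧ y ∈ P :=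
  ⟨fun h => ⟨hP.mem_of_le h (le_join_left x y), hP.mem_of_le h (le_join_right x y)⟩,
    fun h => hP.mem_of_le (hP.add_mem h.1 h.2) (join_le_add x y)⟩

theorem IsPrimeIdeal.meet_mem_iff {P : Set A} (hP : IsPrimeIdeal P) (x y : A) :
    meet x y ∈ P ↔ x ∈ P ∨ y ∈ P :=
  ⟨hP.mem_or_mem, fun h => h.elim (fun h => hP.mem_of_le h (meet_le_left x y))
    (fun h => hP.mem_of_le h (meet_le_right x y))⟩

theorem IsPrimeIdeal.zero_mem {P : Set A} (hP : IsPrimeIdeal P) : (0 : A) ∈ P := by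
  obtain ⟨x, hx⟩ := hP.nonempty
  exact hP.mem_of_le hx (zero_le x)

theorem IsPrimeIdeal.one_notMem {P : Set A} (hP : IsPrimeIdeal P) : (one : A) ∉ P :=
  fun h => hP.ne_univ (Set.eq_univ_of_forall fun x => hP.mem_of_le h (le_one x))

/-- The prime spectrum of an MV-algebra. -/
def Spec (A : Type u) [MVAlgebra A] : Type u := {P : Set A // IsPrimeIdeal P}

end MVAlgebra

/-- Homomorphisms of MV-algebras. -/
structure MVHom (A B : Type u) [MVAlgebra A] [MVAlgebra B] where
  toFun : A → B
  map_zero : toFun 0 = 0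
  map_add : ∀ x y : A, toFun (x + y) = toFun x + toFun y
  map_compl : ∀ x : A, toFun xᶜ = (toFun x)ᶜ

/-- `A` is a free MV-algebra: it is freely generated by some family of generators (finite or
infinite, possibly empty). -/
def IsFreeMV (A : Type u) [MVAlgebra A] : Prop :=
  ∃ (X : Type u) (ι : X → A), ∀ (B : Type u) [MVAlgebra B] (φ : X → B),
    ∃! h : MVHom A B, ∀ x, h.toFun (ι x) = φ x

/-! ## The Belluce lattice of an MV-algebra -/

/-- Two elements of an MV-algebra are identified when they belong to the same prime ideals. -/
def belluceSetoid (A : Type u) [MVAlgebra A] : Setoid A where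
  r x y := ∀ P : MVAlgebra.Spec A, x ∈ P.1 ↔ y ∈ P.1
  iseqv := ⟨fun _ _ => Iff.rfl, fun h P => (h P).symm, fun h k P => (h P).trans (k P)⟩

/-- The Belluce lattice `β(A)`, a quotient of `A`. -/
def Belluce (A : Type u) [MVAlgebra A] : Type u := Quotient (belluceSetoid A)

namespace Belluce

open MVAlgebra

variable {A : Type u} [MVAlgebra A]

/-- The class of an element. -/
def mk (x : A) : Belluce A := Quotient.mk (belluceSetoid A) x

/-- The set of prime ideals which omit a given class. -/
def omit' (a : Belluce A) : Set (Spec A) :=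
  Quotient.liftOn a (fun x => {P : Spec A | x ∉ P.1}) (fun _ _ h => Set.ext fun P => not_congr (h P))

theorem omit'_injective : Function.Injective (omit' : Belluce A → Set (Spec A)) := by
  rintro ⟨x⟩ ⟨y⟩ h
  exact Quotient.sound fun P => not_iff_not.1 (Set.ext_iff.1 h P)

/-- `[x] ∨ [y] = [x ∨ y]`. -/
instance : Max (Belluce A) where
  max := Quotient.map₂ join fun _ _ h _ _ k P => by
    rw [P.2.join_mem_iff, P.2.join_mem_iff, h P, k P]

/-- `[x] ∧ [y] = [x ∧ y]`. -/
instance : Min (Belluce A) where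
  min := Quotient.map₂ meet fun _ _ h _ _ k P => by
    rw [P.2.meet_mem_iff, P.2.meet_mem_iff, h P, k P]

instance : LE (Belluce A) := ⟨fun a b => omit' a ⊆ omit' b⟩

instance : LT (Belluce A) := ⟨fun a b => omit' a ⊂ omit' b⟩

instance : DistribLattice (Belluce A) :=
  omit'_injective.distribLattice omit' Iff.rfl Iff.rfl
    (by
      rintro ⟨x⟩ ⟨y⟩
      ext P
      exact (not_congr (P.2.join_mem_iff x y)).trans not_and_or)
    (by
      rintro ⟨x⟩ ⟨y⟩
      ext P
      exact (not_congr (P.2.meet_mem_iff x y)).trans not_or)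

instance : BoundedOrder (Belluce A) where
  bot := mk 0
  bot_le _ P hP := absurd P.2.zero_mem hP
  top := mk one
  le_top _ P _ := P.2.one_notMem

end Belluce

/-! ## The prime spectrum of a bounded distributive lattice -/

/-- The set of prime ideals of a bounded distributive lattice, ordered by inclusion. -/
def LatSpec (L : Type u) [DistribLattice L] [BoundedOrder L] : Type u :=
  {P : Order.Ideal L // P.IsPrime}

namespace LatSpec

variable {L M : Type u} [DistribLattice L] [BoundedOrder L] [DistribLattice M] [BoundedOrder M]

instance : PartialOrder (LatSpec L) := inferInstanceAs (PartialOrder {P : Order.Ideal L // P.IsPrime})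

/-- The patch topology, generated by the sets `{P | a ∈ P}` and `{P | a ∉ P}`. -/
instance patch : TopologicalSpace (LatSpec L) :=
  TopologicalSpace.generateFrom
    {U | ∃ a : L, U = {P : LatSpec L | a ∈ P.1} ∨ U = {P : LatSpec L | a ∉ P.1}}

/-- The Zariski (Stone) topology, generated by the sets `{P | a ∉ P}`. -/
@[reducible] def zariski (L : Type u) [DistribLattice L] [BoundedOrder L] : TopologicalSpace (LatSpec L) :=
  TopologicalSpace.generateFrom {U | ∃ a : L, U = {P : LatSpec L | a ∉ P.1}}

theorem top_notMem (P : LatSpec L) : ⊤ ∉ P.1 := fun h =>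
  P.2.toIsProper.ne_univ (Set.eq_univ_of_forall fun _ => P.1.lower le_top h)

theorem inf_mem_iff (P : LatSpec L) (a b : L) : a ⊓ b ∈ P.1 ↔ a ∈ P.1 ∨ b ∈ P.1 :=
  ⟨P.2.mem_or_mem, fun h => h.elim (P.1.lower inf_le_left) (P.1.lower inf_le_right)⟩

/-- A set of lattice elements with the properties of a prime ideal, as a point of the spectrum. -/
def mk' (S : Set L) (hbot : ⊥ ∈ S) (htop : ⊤ ∉ S) (hsup : ∀ a b, a ⊔ b ∈ S ↔ a ∈ S ∧ b ∈ S)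
    (hinf : ∀ a b, a ⊓ b ∈ S ↔ a ∈ S ∨ b ∈ S) : LatSpec L :=
  let I : Order.Ideal L :=
    { carrier := S
      lower' := fun a b hba ha => ((hsup a b).1 (by rwa [sup_eq_left.2 hba])).2
      nonempty' := ⟨⊥, hbot⟩
      directed' := fun a ha b hb => ⟨a ⊔ b, (hsup a b).2 ⟨ha, hb⟩, le_sup_left, le_sup_right⟩ }
  ⟨I, by
    have : I.IsProper := Order.Ideal.isProper_of_notMem (p := ⊤) htop
    exact Order.Ideal.IsPrime.of_mem_or_mem fun {a b} h => (hinf a b).1 h⟩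

theorem isClopen_mem (a : L) : IsClopen {P : LatSpec L | a ∈ P.1} :=
  ⟨⟨TopologicalSpace.isOpen_generateFrom_of_mem ⟨a, Or.inr rfl⟩⟩,
    TopologicalSpace.isOpen_generateFrom_of_mem ⟨a, Or.inl rfl⟩⟩

/-- The prime ideal cut out by a `{0, 1}`-valued function which respects the operations. -/
def ofFun (χ : L → Bool) (hbot : χ ⊥ = true) (htop : χ ⊤ = false)
    (hsup : ∀ a b, χ (a ⊔ b) = (χ a && χ b)) (hinf : ∀ a b, χ (a ⊓ b) = (χ a || χ b)) :
    LatSpec L :=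
  mk' {a | χ a = true} hbot (fun h => Bool.noConfusion (htop.symm.trans h))
    (fun a b => by change χ (a ⊔ b) = true ↔ _; rw [hsup, Bool.and_eq_true]; rfl)
    (fun a b => by change χ (a ⊓ b) = true ↔ _; rw [hinf, Bool.or_eq_true]; rfl)

open Classical in
/-- The characteristic function of a prime ideal. -/
noncomputable def char (P : LatSpec L) : L → Bool := fun a => decide (a ∈ P.1)

theorem isInducing_char : Topology.IsInducing (char : LatSpec L → L → Bool) := by
  constructor
  apply le_antisymm
  · rw [← continuous_iff_le_induced]
    refine continuous_pi fun a => ?_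
    rw [continuous_discrete_rng]
    rintro (_ | _)
    · convert (isClopen_mem a).compl.isOpen using 1
      ext P
      simp [char]
    · convert (isClopen_mem a).isOpen using 1
      ext P
      simp [char]
  · refine le_generateFrom ?_
    rintro U ⟨a, rfl | rfl⟩
    · refine ⟨(fun χ : L → Bool => χ a) ⁻¹' {true},
        (isOpen_discrete _).preimage (continuous_apply a), ?_⟩
      ext P
      simp [char]
    · refine ⟨(fun χ : L → Bool => χ a) ⁻¹' {false},
        (isOpen_discrete _).preimage (continuous_apply a), ?_⟩
      ext P
      simp [char]

theorem range_char : Set.range (char : LatSpec L → L → Bool) =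
    {χ | χ ⊥ = true} ∩ {χ | χ ⊤ = false} ∩
      ((⋂ a, ⋂ b, {χ | χ (a ⊔ b) = (χ a && χ b)}) ∩
        ⋂ a, ⋂ b, {χ | χ (a ⊓ b) = (χ a || χ b)}) := by
  ext χ
  simp only [Set.mem_range, Set.mem_inter_iff, Set.mem_iInter, Set.mem_ofPred_eq]
  constructor
  · rintro ⟨P, rfl⟩
    refine ⟨⟨by simp [char], by simpa [char] using top_notMem P⟩, fun a b => ?_, fun a b => ?_⟩
    · rw [Bool.eq_iff_iff]
      simp [char, Order.Ideal.sup_mem_iff]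
    · rw [Bool.eq_iff_iff]
      simp [char, inf_mem_iff]
  · rintro ⟨⟨h1, h2⟩, h3, h4⟩
    refine ⟨ofFun χ h1 h2 h3 h4, ?_⟩
    funext a
    have : a ∈ (ofFun χ h1 h2 h3 h4).1 ↔ χ a = true := Iff.rfl
    simp [char, this]

instance : CompactSpace (LatSpec L) := by
  rw [← isCompact_univ_iff, isInducing_char.isCompact_iff, Set.image_univ, range_char]
  refine IsClosed.isCompact ?_
  refine ((isClosed_eq (continuous_apply _) continuous_const).inter
    (isClosed_eq (continuous_apply _) continuous_const)).inter
    ((isClosed_iInter fun a => isClosed_iInter fun b => isClosed_eq (continuous_apply _) ?_).inter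
      (isClosed_iInter fun a => isClosed_iInter fun b => isClosed_eq (continuous_apply _) ?_))
  · exact (continuous_of_discreteTopology (f := fun p : Bool × Bool => (p.1 && p.2))).comp
      (show Continuous fun χ : L → Bool => (χ a, χ b) from
        (continuous_apply a).prodMk (continuous_apply b))
  · exact (continuous_of_discreteTopology (f := fun p : Bool × Bool => (p.1 || p.2))).comp
      (show Continuous fun χ : L → Bool => (χ a, χ b) from
        (continuous_apply a).prodMk (continuous_apply b))

instance : PriestleySpace (LatSpec L) where
  priestley {P Q} h := by
    obtain ⟨a, haP, haQ⟩ := Set.not_subset.1 h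
    exact ⟨{R | a ∈ R.1}, isClopen_mem a, fun _ _ hle ha => hle ha, haP, haQ⟩

/-- A set of prime ideals is closed in the Zariski topology iff it is a closed upset in the patch
topology. -/
theorem isClosed_zariski_iff (C : Set (LatSpec L)) :
    IsClosed[zariski L] C ↔ IsClosed C ∧ IsUpperSet C := by
  constructor
  · intro hC
    have hO : IsOpen[zariski L] Cᶜ := @IsClosed.isOpen_compl _ (zariski L) C hC
    have key : IsOpen Cᶜ ∧ IsLowerSet Cᶜ := by
      generalize Cᶜ = U at hO
      induction hO with
      | basic U hU =>
        obtain ⟨a, rfl⟩ := hU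
        exact ⟨(isClopen_mem a).compl.isOpen, fun P Q hle hP hQ => hP (hle hQ)⟩
      | univ => exact ⟨isOpen_univ, isLowerSet_univ⟩
      | inter U V _ _ hU hV => exact ⟨hU.1.inter hV.1, hU.2.inter hV.2⟩
      | sUnion S _ hS =>
        exact ⟨isOpen_sUnion fun U hU => (hS U hU).1, isLowerSet_sUnion fun U hU => (hS U hU).2⟩
    exact ⟨⟨key.1⟩, isLowerSet_compl.1 key.2⟩
  · rintro ⟨hC, hup⟩
    refine @IsClosed.mk _ (zariski L) _ ?_
    rw [@isOpen_iff_forall_mem_open _ (zariski L) _]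
    intro P hP
    have hne : ∀ Q : C, ∃ a : L, a ∈ Q.1.1 ∧ a ∉ P.1 := fun Q =>
      Set.not_subset.1 fun h => hP (hup (show Q.1 ≤ P from h) Q.2)
    choose a haQ haP using hne
    obtain ⟨t, ht⟩ := hC.isCompact.elim_finite_subcover
      (fun Q : C => {R : LatSpec L | a Q ∈ R.1}) (fun Q => (isClopen_mem (a Q)).isOpen)
      fun Q hQ => Set.mem_iUnion.2 ⟨⟨Q, hQ⟩, haQ ⟨Q, hQ⟩⟩
    refine ⟨{R | t.inf a ∉ R.1}, ?_, TopologicalSpace.isOpen_generateFrom_of_mem ⟨_, rfl⟩, ?_⟩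
    · intro R hR hRC
      obtain ⟨Q, hQt, hQ⟩ := Set.mem_iUnion₂.1 (ht hRC)
      exact hR (R.1.lower (Finset.inf_le hQt) hQ)
    · have : ∀ s : Finset C, s.inf a ∉ P.1 := fun s => by
        classical
        induction s using Finset.induction_on with
        | empty => simpa using top_notMem P
        | insert Q s _ ih =>
          rw [Finset.inf_insert, inf_mem_iff]
          exact fun h => h.elim (haP Q) ih
      exact this t

/-- The inverse image of a prime ideal under a homomorphism of bounded lattices. -/
def comap (f : BoundedLatticeHom L M) (P : LatSpec M) : LatSpec L :=
  mk' {a | f a ∈ P.1} (by simp) (by simpa using top_notMem P)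
    (fun a b => by simp [Order.Ideal.sup_mem_iff])
    (fun a b => by simp [inf_mem_iff])

theorem mem_comap (f : BoundedLatticeHom L M) (P : LatSpec M) (a : L) :
    a ∈ (comap f P).1 ↔ f a ∈ P.1 := Iff.rfl

theorem ext_mem {P Q : LatSpec L} (h : ∀ a, a ∈ P.1 ↔ a ∈ Q.1) : P = Q :=
  Subtype.ext (Order.Ideal.ext (Set.ext h))

theorem continuous_comap (f : BoundedLatticeHom L M) : Continuous (comap f) := by
  refine continuous_generateFrom_iff.2 ?_
  rintro U ⟨a, rfl | rfl⟩
  · exact (isClopen_mem (f a)).isOpen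
  · exact (isClopen_mem (f a)).compl.isOpen

open Classical in
/-- The homomorphism to the two-element lattice with a given prime ideal as its kernel. -/
noncomputable def toTwo (P : LatSpec L) : BoundedLatticeHom L (ULift.{u} Bool) where
  toFun a := ⟨decide (a ∉ P.1)⟩
  map_sup' a b := by
    apply ULift.ext
    simp [Order.Ideal.sup_mem_iff, imp_iff_not_or]
  map_inf' a b := by
    apply ULift.ext
    simp [inf_mem_iff]
  map_top' := by
    apply ULift.ext
    simpa using top_notMem P
  map_bot' := by
    apply ULift.ext
    simp

theorem toTwo_apply_eq_iff (P Q : LatSpec L) (a b : L) :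
    toTwo P a = toTwo Q b ↔ (a ∈ P.1 ↔ b ∈ Q.1) := by
  classical
  change (⟨decide (a ∉ P.1)⟩ : ULift.{u} Bool) = ⟨decide (b ∉ Q.1)⟩ ↔ _
  rw [ULift.up_inj, decide_eq_decide, not_iff_not]

end LatSpec

/-! ## Priestley spaces and Priestley duality -/

/-- The category of Priestley spaces; morphisms are the continuous order-preserving maps. -/
structure PriesCat : Type (u + 1) where
  carrier : Type u
  [order : PartialOrder carrier]
  [top : TopologicalSpace carrier]
  [compact : CompactSpace carrier]
  [priestley : PriestleySpace carrier]

namespace PriesCat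

attribute [instance] order top compact priestley

instance : Category PriesCat.{u} where
  Hom X Y := X.carrier →Co Y.carrier
  id X := ContinuousOrderHom.id X.carrier
  comp f g := ContinuousOrderHom.comp g f

/-- The underlying map of a Priestley map. -/
def fn {X Y : PriesCat.{u}} (g : X ⟶ Y) : X.carrier → Y.carrier :=
  (show X.carrier →Co Y.carrier from g)

/-- A Priestley map preserves closed upsets if it sends closed upsets to closed upsets. -/
def PreservesClosedUpsets {X Y : PriesCat.{u}} (g : X ⟶ Y) : Prop :=
  ∀ C : Set X.carrier, IsClosed C → IsUpperSet C → IsClosed (fn g '' C) ∧ IsUpperSet (fn g '' C)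

theorem hom_ext' {X Y : PriesCat.{u}} {f g : X ⟶ Y} (h : ∀ x, fn f x = fn g x) : f = g :=
  ContinuousOrderHom.ext h

end PriesCat

/-- The Priestley duality functor: a lattice is sent to its set of prime ideals with inclusion and
the patch topology, a homomorphism is sent to the inverse image map. -/
def priestleyDual : BddDistLat.{u}ᵒᵖ ⥤ PriesCat.{u} where
  obj L := { carrier := LatSpec L.unop }
  map {L M} f := (show LatSpec L.unop →Co LatSpec M.unop from
    { toFun := LatSpec.comap f.unop.hom
      monotone' := fun _ _ h _ ha => h ha
      continuous_toFun := LatSpec.continuous_comap f.unop.hom })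
  map_id _ := rfl
  map_comp _ _ := rfl

/-! ## Lattices in context and Priestley spaces in context -/

/-- The lattice `K` is (isomorphic to) the Belluce lattice of a free MV-algebra. -/
def IsFreeBelluce (K : BddDistLat.{u}) : Prop :=
  ∃ (A : Type u) (_ : MVAlgebra A), IsFreeMV A ∧ Nonempty (K ≅ BddDistLat.of (Belluce A))

/-- The Stone dual of `f`, i.e. the inverse image map between the prime spectra with their Zariski
topologies, preserves closed sets. -/
def StoneDualPreservesClosed {K L : BddDistLat.{u}} (f : K ⟶ L) : Prop :=
  ∀ C : Set (LatSpec L), IsClosed[LatSpec.zariski L] C →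
    IsClosed[LatSpec.zariski K] (LatSpec.comap f.hom '' C)

/-- Objects of `LIC` (lattices in context). -/
structure LIC : Type (u + 1) where
  base : BddDistLat.{u}
  base_free : IsFreeBelluce base
  lat : BddDistLat.{u}
  f : base ⟶ lat
  epi : Epi f
  closed : StoneDualPreservesClosed f

namespace LIC

/-- Morphisms of `LIC`: pairs of lattice homomorphisms which form a commutative square. -/
@[ext]
structure Hom (X Y : LIC.{u}) where
  s : X.base ⟶ Y.base
  t : X.lat ⟶ Y.lat
  comm : X.f ≫ t = s ≫ Y.f

instance : Category LIC.{u} where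
  Hom := Hom
  id X := ⟨𝟙 _, 𝟙 _, by simp⟩
  comp φ ψ := ⟨φ.s ≫ ψ.s, φ.t ≫ ψ.t, by
    rw [← Category.assoc, φ.comm, Category.assoc, ψ.comm, Category.assoc]⟩

end LIC

/-- Objects of `PIC` (Priestley in context). -/
structure PIC : Type (u + 1) where
  base : PriesCat.{u}
  base_free : ∃ (A : Type u) (_ : MVAlgebra A), IsFreeMV A ∧
    Nonempty (base ≅ priestleyDual.obj (Opposite.op (BddDistLat.of (Belluce A))))
  space : PriesCat.{u}
  g : space ⟶ base
  injective : Function.Injective (PriesCat.fn g)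
  closed : PriesCat.PreservesClosedUpsets g

namespace PIC

/-- Morphisms of `PIC`: pairs of Priestley maps which form a commutative square. -/
@[ext]
structure Hom (X Y : PIC.{u}) where
  s : X.base ⟶ Y.base
  t : X.space ⟶ Y.space
  comm : t ≫ Y.g = X.g ≫ s

instance : Category PIC.{u} where
  Hom := Hom
  id X := ⟨𝟙 _, 𝟙 _, by simp⟩
  comp φ ψ := ⟨φ.s ≫ ψ.s, φ.t ≫ ψ.t, by
    rw [Category.assoc, ψ.comm, ← Category.assoc, φ.comm, Category.assoc]⟩

end PIC

theorem comap_injective_of_epi {K L : BddDistLat.{u}} (f : K ⟶ L) [Epi f] :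
    Function.Injective (LatSpec.comap f.hom) := by
  intro P Q h
  have key : BddDistLat.ofHom (LatSpec.toTwo P) = BddDistLat.ofHom (LatSpec.toTwo Q) := by
    rw [← cancel_epi f]
    refine BddDistLat.ext fun a => ?_
    refine (LatSpec.toTwo_apply_eq_iff P Q (f a) (f a)).2 ?_
    exact (LatSpec.mem_comap f.hom P a).symm.trans
      ((h ▸ Iff.rfl : a ∈ (LatSpec.comap f.hom P).1 ↔ a ∈ (LatSpec.comap f.hom Q).1).trans
        (LatSpec.mem_comap f.hom Q a))
  refine LatSpec.ext_mem fun a => (LatSpec.toTwo_apply_eq_iff P Q a a).1 ?_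
  exact congrArg (fun k : L ⟶ BddDistLat.of (ULift.{u} Bool) => k a) key

/-- Priestley duality applied componentwise: `(K, L, f)` is sent to the triple consisting of the
Priestley duals of `K`, `L` and `f`, and `(s, t)` to the pair of the Priestley duals of `s`, `t`. -/
def priestleyInContext : LIC.{u}ᵒᵖ ⥤ PIC.{u} where
  obj X :=
    { base := priestleyDual.obj (Opposite.op X.unop.base)
      base_free := by
        obtain ⟨A, inst, hA, ⟨e⟩⟩ := X.unop.base_free
        exact ⟨A, inst, hA, ⟨priestleyDual.mapIso e.symm.op⟩⟩
      space := priestleyDual.obj (Opposite.op X.unop.lat)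
      g := priestleyDual.map X.unop.f.op
      injective := by
        have := X.unop.epi
        exact comap_injective_of_epi X.unop.f
      closed := fun C hC hup =>
        (LatSpec.isClosed_zariski_iff _).1
          (X.unop.closed C ((LatSpec.isClosed_zariski_iff C).2 ⟨hC, hup⟩)) }
  map φ :=
    { s := priestleyDual.map φ.unop.s.op
      t := priestleyDual.map φ.unop.t.op
      comm := by
        rw [← Functor.map_comp, ← Functor.map_comp, ← op_comp, ← op_comp, φ.unop.comm] }
  map_id _ := rfl
  map_comp _ _ := rfl

namespace LatSpec

variable {L M : Type u} [DistribLattice L] [BoundedOrder L] [DistribLattice M] [BoundedOrder M]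

theorem le_of_forall_mem {a b : L} (h : ∀ P : LatSpec L, b ∈ P.1 → a ∈ P.1) : a ≤ b := by
  by_contra hab
  have hdisj : Disjoint (Order.PFilter.principal a : Set L) (Order.Ideal.principal b : Set L) :=
    Set.disjoint_left.2 fun c hac hcb => hab (le_trans hac hcb)
  obtain ⟨J, hJ, hbJ, haJ⟩ := DistribLattice.prime_ideal_of_disjoint_filter_ideal hdisj
  exact Set.disjoint_left.1 haJ (show a ∈ (Order.PFilter.principal a : Set L) from le_rfl)
    (h ⟨J, hJ⟩ (hbJ (show b ∈ Order.Ideal.principal b from le_rfl)))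

theorem eq_of_forall_mem_iff {a b : L} (h : ∀ P : LatSpec L, a ∈ P.1 ↔ b ∈ P.1) : a = b :=
  le_antisymm (le_of_forall_mem fun P => (h P).2) (le_of_forall_mem fun P => (h P).1)

theorem finset_inf_mem_iff {ι : Type*} (P : LatSpec L) (s : Finset ι) (a : ι → L) :
    s.inf a ∈ P.1 ↔ ∃ i ∈ s, a i ∈ P.1 := by
  classical
  induction s using Finset.induction_on with
  | empty => simpa using top_notMem P
  | insert i s _ ih => simp [inf_mem_iff, ih]

theorem finset_sup_mem_iff {ι : Type*} (P : LatSpec L) (s : Finset ι) (a : ι → L) :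
    s.sup a ∈ P.1 ↔ ∀ i ∈ s, a i ∈ P.1 := by
  classical
  induction s using Finset.induction_on with
  | empty => simp
  | insert i s _ ih => simp [Order.Ideal.sup_mem_iff, ih]

/-- A closed upset of prime ideals is separated from any point outside it by a lattice element. -/
theorem exists_mem_of_isClosed_isUpperSet {C : Set (LatSpec L)} (hC : IsClosed C)
    (hup : IsUpperSet C) {P : LatSpec L} (hP : P ∉ C) : ∃ a ∉ P.1, ∀ R ∈ C, a ∈ R.1 := by
  have hne : ∀ Q : C, ∃ a : L, a ∈ Q.1.1 ∧ a ∉ P.1 := fun Q =>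
    Set.not_subset.1 fun h => hP (hup (show Q.1 ≤ P from h) Q.2)
  choose a haQ haP using hne
  obtain ⟨t, ht⟩ := hC.isCompact.elim_finite_subcover
    (fun Q : C => {R : LatSpec L | a Q ∈ R.1}) (fun Q => (isClopen_mem (a Q)).isOpen)
    fun Q hQ => Set.mem_iUnion.2 ⟨⟨Q, hQ⟩, haQ ⟨Q, hQ⟩⟩
  refine ⟨t.inf a, fun h => ?_, fun R hR => ?_⟩
  · obtain ⟨Q, _, hQ⟩ := (finset_inf_mem_iff P t a).1 h
    exact haP Q hQ
  · obtain ⟨Q, hQt, hQ⟩ := Set.mem_iUnion₂.1 (ht hR)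
    exact (finset_inf_mem_iff R t a).2 ⟨Q, hQt, hQ⟩

/-- Every clopen upset of the Priestley dual is given by a lattice element. -/
theorem exists_forall_mem_iff_of_isClopen {U : Set (LatSpec L)} (hU : IsClopen U)
    (hup : IsUpperSet U) : ∃ a : L, ∀ P : LatSpec L, a ∈ P.1 ↔ P ∈ U := by
  have hne : ∀ P : (Uᶜ : Set (LatSpec L)), ∃ a ∉ P.1.1, ∀ R ∈ U, a ∈ R.1 := fun P =>
    exists_mem_of_isClosed_isUpperSet hU.isClosed hup P.2
  choose a haP haU using hne
  obtain ⟨t, ht⟩ := hU.compl.isClosed.isCompact.elim_finite_subcover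
    (fun P : (Uᶜ : Set (LatSpec L)) => {R : LatSpec L | a P ∉ R.1})
    (fun P => (isClopen_mem (a P)).compl.isOpen)
    fun P hP => Set.mem_iUnion.2 ⟨⟨P, hP⟩, haP ⟨P, hP⟩⟩
  refine ⟨t.sup a, fun R => ?_⟩
  rw [finset_sup_mem_iff]
  refine ⟨fun h => ?_, fun hR P _ => haU P R hR⟩
  by_contra hR
  obtain ⟨P, hPt, hP⟩ := Set.mem_iUnion₂.1 (ht hR)
  exact hP (h P hPt)

theorem comap_injective_hom {f g : BoundedLatticeHom L M} (h : comap f = comap g) : f = g :=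
  DFunLike.ext _ _ fun a => eq_of_forall_mem_iff fun P => by
    rw [← mem_comap, ← mem_comap, h]

/-- Every Priestley map between Priestley duals is the dual of a homomorphism. -/
theorem exists_comap_eq (h : LatSpec L →Co LatSpec M) :
    ∃ f : BoundedLatticeHom M L, ∀ P, comap f P = h P := by
  have hex : ∀ a : M, ∃ b : L, ∀ P : LatSpec L, b ∈ P.1 ↔ a ∈ (h P).1 := fun a =>
    exists_forall_mem_iff_of_isClopen ((isClopen_mem a).preimage h.continuous_toFun)
      fun _ _ hle ha => h.monotone' hle ha
  choose f hf using hex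
  exact ⟨{  toFun := f
            map_sup' := fun a b => eq_of_forall_mem_iff fun P => by
              simp only [Order.Ideal.sup_mem_iff, hf]
            map_inf' := fun a b => eq_of_forall_mem_iff fun P => by
              simp only [inf_mem_iff, hf]
            map_top' := eq_of_forall_mem_iff fun P => by
              simp only [top_notMem, hf]
            map_bot' := eq_of_forall_mem_iff fun P => by
              simp only [Order.Ideal.bot_mem, hf] },
    fun P => ext_mem fun a => hf a P⟩

end LatSpec

instance ClopenUpperSet.instDistribLattice {X : Type*} [TopologicalSpace X] [LE X] :
    DistribLattice (ClopenUpperSet X) where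
  le_sup_inf _ _ _ := (Set.union_inter_distrib_left _ _ _).ge

namespace ClopenUpperSet

variable {X : Type u} [PartialOrder X] [TopologicalSpace X]

/-- The prime ideal of the clopen upsets, ordered by reverse inclusion, which contain a point. -/
def point (x : X) : LatSpec (ClopenUpperSet X)ᵒᵈ :=
  LatSpec.mk' {U | x ∈ OrderDual.ofDual U} (Set.mem_univ x) (Set.notMem_empty x)
    (fun _ _ => Iff.rfl) (fun _ _ => Iff.rfl)

theorem continuous_point : Continuous (point : X → LatSpec (ClopenUpperSet X)ᵒᵈ) := by
  refine continuous_generateFrom_iff.2 ?_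
  rintro _ ⟨U, rfl | rfl⟩
  · exact (OrderDual.ofDual U).isClopen.isOpen
  · exact (OrderDual.ofDual U).isClopen.compl.isOpen

theorem point_le_point_iff [PriestleySpace X] {x y : X} : point x ≤ point y ↔ x ≤ y := by
  refine ⟨fun h => ?_, fun h U hU => (OrderDual.ofDual U).upper h hU⟩
  by_contra hxy
  obtain ⟨U, hU, hup, hx, hy⟩ := exists_isClopen_upper_of_not_le hxy
  exact hy (@h (OrderDual.toDual (⟨⟨U, hU⟩, hup⟩ : ClopenUpperSet X)) hx)

theorem point_surjective [CompactSpace X] :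
    Function.Surjective (point : X → LatSpec (ClopenUpperSet X)ᵒᵈ) := by
  classical
  intro P
  let C : (ClopenUpperSet X)ᵒᵈ → Set X := fun U =>
    {x | x ∈ OrderDual.ofDual U ↔ U ∈ P.1}
  have hC : ∀ U, IsClosed (C U) := fun U => by
    by_cases hU : U ∈ P.1
    · simpa [C, hU] using (OrderDual.ofDual U).isClopen.isClosed
    · simp only [C, hU, iff_false]
      exact (OrderDual.ofDual U).isClopen.compl.isClosed
  obtain ⟨x, hx⟩ := CompactSpace.iInter_nonempty hC fun t => by
    let a := (t.filter (· ∈ P.1)).sup id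
    let b := (t.filter (· ∉ P.1)).inf id
    have ha : a ∈ P.1 := (LatSpec.finset_sup_mem_iff _ _ _).2 fun U hU => (Finset.mem_filter.1 hU).2
    have hb : b ∉ P.1 := fun h => by
      obtain ⟨U, hU, hUP⟩ := (LatSpec.finset_inf_mem_iff _ _ _).1 h
      exact (Finset.mem_filter.1 hU).2 hUP
    have hab : ¬ ((OrderDual.ofDual a : ClopenUpperSet X) : Set X) ⊆
        (OrderDual.ofDual b : ClopenUpperSet X) := fun h =>
      hb (P.1.lower (show b ≤ a from h) ha)
    obtain ⟨x, hxa, hxb⟩ := Set.not_subset.1 hab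
    refine ⟨x, Set.mem_iInter₂.2 fun U hU => ?_⟩
    by_cases hUP : U ∈ P.1
    · exact iff_of_true ((Finset.le_sup (f := id) (Finset.mem_filter.2 ⟨hU, hUP⟩) : U ≤ a) hxa) hUP
    · exact iff_of_false
        (fun h => hxb ((Finset.inf_le (f := id) (Finset.mem_filter.2 ⟨hU, hUP⟩) : b ≤ U) h)) hUP
  exact ⟨x, LatSpec.ext_mem fun U => Set.mem_iInter.1 hx U⟩

end ClopenUpperSet

namespace PriesCat

/-- A bijective order embedding which is continuous is an isomorphism of Priestley spaces. -/
noncomputable def isoOfBijective {X Y : PriesCat.{u}} (g : X.carrier → Y.carrier)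
    (hg : Continuous g) (hle : ∀ x y, g x ≤ g y ↔ x ≤ y) (hsurj : Function.Surjective g) :
    X ≅ Y :=
  let e : X.carrier ≃ Y.carrier := Equiv.ofBijective g
    ⟨fun x y h => le_antisymm ((hle x y).1 h.le) ((hle y x).1 h.ge), hsurj⟩
  { hom := (show X.carrier →Co Y.carrier from
      { toFun := e
        monotone' := fun x y => (hle x y).2
        continuous_toFun := hg })
    inv := (show Y.carrier →Co X.carrier from
      { toFun := e.symm
        monotone' := fun x y h => (hle _ _).1 (by
          change e (e.symm x) ≤ e (e.symm y)
          simpa using h)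
        continuous_toFun := (show Continuous e from hg).continuous_symm_of_equiv_compact_to_t2 })
    hom_inv_id := hom_ext' e.symm_apply_apply
    inv_hom_id := hom_ext' e.apply_symm_apply }

variable {X Y Z : PriesCat.{u}}

theorem fn_hom_inv (e : X ≅ Y) (y : Y.carrier) : fn e.hom (fn e.inv y) = y :=
  congrArg (fun k => fn k y) e.inv_hom_id

theorem fn_inv_hom (e : X ≅ Y) (x : X.carrier) : fn e.inv (fn e.hom x) = x :=
  congrArg (fun k => fn k x) e.hom_inv_id

theorem mono_of_injective (g : X ⟶ Y) (hg : Function.Injective (fn g)) : Mono g :=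
  ⟨fun _ _ hk => hom_ext' fun x => hg (congrArg (fun k => fn k x) hk)⟩

theorem fn_injective_of_iso (e : X ≅ Y) : Function.Injective (fn e.hom) :=
  Function.LeftInverse.injective (fn_inv_hom e)

theorem continuous_fn (g : X ⟶ Y) : Continuous (fn g) :=
  ContinuousOrderHom.continuous_toFun g

theorem monotone_fn (g : X ⟶ Y) : Monotone (fn g) :=
  OrderHomClass.mono (show X.carrier →Co Y.carrier from g)

theorem preservesClosedUpsets_of_iso (e : X ≅ Y) : PreservesClosedUpsets e.hom := by
  intro C hC hup
  rw [Set.image_eq_preimage_of_inverse (fn_inv_hom e) (fn_hom_inv e)]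
  exact ⟨hC.preimage (continuous_fn e.inv), hup.preimage (monotone_fn e.inv)⟩

theorem PreservesClosedUpsets.comp {f : X ⟶ Y} {g : Y ⟶ Z} (hf : PreservesClosedUpsets f)
    (hg : PreservesClosedUpsets g) : PreservesClosedUpsets (f ≫ g) := by
  intro C hC hup
  have h := hg _ (hf C hC hup).1 (hf C hC hup).2
  rwa [Set.image_image] at h

end PriesCat

instance priestleyDual_faithful : priestleyDual.{u}.Faithful where
  map_injective {L M f g} h := by
    apply Quiver.Hom.unop_inj
    apply BddDistLat.ext
    refine DFunLike.congr_fun (LatSpec.comap_injective_hom (f := f.unop.hom) (g := g.unop.hom) ?_)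
    exact congrArg PriesCat.fn h

instance priestleyDual_full : priestleyDual.{u}.Full where
  map_surjective {L M} h := by
    obtain ⟨f, hf⟩ := LatSpec.exists_comap_eq (show LatSpec L.unop →Co LatSpec M.unop from h)
    exact ⟨(BddDistLat.ofHom f).op, PriesCat.hom_ext' hf⟩

instance priestleyDual_essSurj : priestleyDual.{u}.EssSurj where
  mem_essImage X :=
    ⟨Opposite.op (BddDistLat.of (ClopenUpperSet X.carrier)ᵒᵈ),
      ⟨(PriesCat.isoOfBijective (Y := priestleyDual.obj _) ClopenUpperSet.point
        ClopenUpperSet.continuous_point (fun _ _ => ClopenUpperSet.point_le_point_iff)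
        ClopenUpperSet.point_surjective).symm⟩⟩

/-- **Priestley duality.** -/
instance priestleyDual_isEquivalence : priestleyDual.{u}.IsEquivalence where

theorem stoneDualPreservesClosed_of_preservesClosedUpsets {K L : BddDistLat.{u}} {f : K ⟶ L}
    (h : PriesCat.PreservesClosedUpsets (priestleyDual.map f.op)) :
    StoneDualPreservesClosed f := fun C hC => by
  obtain ⟨hC, hup⟩ := (LatSpec.isClosed_zariski_iff C).1 hC
  exact (LatSpec.isClosed_zariski_iff _).2 (h C hC hup)

theorem epi_of_injective_priestleyDual {K L : BddDistLat.{u}} {f : K ⟶ L}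
    (h : Function.Injective (PriesCat.fn (priestleyDual.map f.op))) : Epi f := by
  have := PriesCat.mono_of_injective _ h
  have : Mono f.op := priestleyDual.mono_of_mono_map this
  exact unop_epi_of_mono f.op

/-- An isomorphism of `PIC` from isomorphisms of the components. -/
def PIC.isoMk {X Y : PIC.{u}} (s : X.base ≅ Y.base) (t : X.space ≅ Y.space)
    (comm : t.hom ≫ Y.g = X.g ≫ s.hom) : X ≅ Y where
  hom := ⟨s.hom, t.hom, comm⟩
  inv := ⟨s.inv, t.inv, by
    rw [Iso.inv_comp_eq, ← Category.assoc, comm, Category.assoc, s.hom_inv_id, Category.comp_id]⟩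
  hom_inv_id := PIC.Hom.ext s.hom_inv_id t.hom_inv_id
  inv_hom_id := PIC.Hom.ext s.inv_hom_id t.inv_hom_id

instance priestleyInContext_faithful : priestleyInContext.{u}.Faithful where
  map_injective {X Y φ ψ} h := by
    apply Quiver.Hom.unop_inj
    apply LIC.Hom.ext
    · exact Quiver.Hom.op_inj (priestleyDual.map_injective (congrArg PIC.Hom.s h))
    · exact Quiver.Hom.op_inj (priestleyDual.map_injective (congrArg PIC.Hom.t h))

instance priestleyInContext_full : priestleyInContext.{u}.Full where
  map_surjective {X Y} φ := by
    obtain ⟨s, hs⟩ := priestleyDual.map_surjective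
      (X := Opposite.op X.unop.base) (Y := Opposite.op Y.unop.base) φ.s
    obtain ⟨t, ht⟩ := priestleyDual.map_surjective
      (X := Opposite.op X.unop.lat) (Y := Opposite.op Y.unop.lat) φ.t
    have comm : t ≫ Y.unop.f.op = X.unop.f.op ≫ s := by
      apply priestleyDual.map_injective
      rw [Functor.map_comp, Functor.map_comp, hs, ht]
      exact φ.comm
    let ψ : Y.unop ⟶ X.unop := LIC.Hom.mk s.unop t.unop (congrArg Quiver.Hom.unop comm)
    exact ⟨ψ.op, PIC.Hom.ext hs ht⟩

instance priestleyInContext_essSurj : priestleyInContext.{u}.EssSurj where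
  mem_essImage X := by
    let eK := priestleyDual.objObjPreimageIso X.base
    let eL := priestleyDual.objObjPreimageIso X.space
    obtain ⟨f, hf⟩ := priestleyDual.map_surjective (eL.hom ≫ X.g ≫ eK.inv)
    have hinj : Function.Injective (PriesCat.fn (priestleyDual.map f)) := by
      rw [hf]
      exact (PriesCat.fn_injective_of_iso eK.symm).comp
        (X.injective.comp (PriesCat.fn_injective_of_iso eL))
    have hclosed : PriesCat.PreservesClosedUpsets (priestleyDual.map f) := by
      rw [hf]
      exact (PriesCat.preservesClosedUpsets_of_iso eL).comp
        (X.closed.comp (PriesCat.preservesClosedUpsets_of_iso eK.symm))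
    let Y : LIC.{u} :=
      { base := (priestleyDual.objPreimage X.base).unop
        base_free := by
          obtain ⟨A, inst, hA, ⟨e⟩⟩ := X.base_free
          exact ⟨A, inst, hA, ⟨(priestleyDual.preimageIso (eK ≪≫ e)).unop.symm⟩⟩
        lat := (priestleyDual.objPreimage X.space).unop
        f := f.unop
        epi := epi_of_injective_priestleyDual hinj
        closed := stoneDualPreservesClosed_of_preservesClosedUpsets hclosed }
    refine ⟨Opposite.op Y, ⟨PIC.isoMk eK eL ?_⟩⟩
    change eL.hom ≫ X.g = priestleyDual.map f ≫ eK.hom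
    simp [hf]

theorem theorem5 : (priestleyInContext.{u} : LIC.{u}ᵒᵖ ⥤ PIC.{u}).IsEquivalence := by
  exact { }
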